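/- All graphs are finite and simple. For a graph $G$ and a vertex $v$, the local complementation $G*v$ is obtained from $G$ by replacing the subgraph induced on the neighbourhood of $v$ by its complement. A graph $H$ with $V(H)\subseteq V(G)$ is a vertex-minor of $G$ if it can be obtained from $G$ through a sequence of local complementations and vertex deletions. A graph $G$ is $k$-vertex-minor universal if for every $U\subseteq V(G)$ with $|U|=k$, every graph on the vertex set $U$ is a vertex-minor of $G$. Let $\mathbb{G}(n,1/2)$ be the random graph on $n$ labelled vertices in which each edge is present independently with probability $1/2$. **Theorem.** For every $c_0>0$ there is a function $\delta:\mathbb{N}\to\mathbb{R}$, depending only on $c_0$, with $\delta(k)\to 0$ as $k\to\infty$, such that for all real $c\ge c_0$ and all natural numbers $k,n$ with $$n\ \ge\ (1+c)\,\frac{1}{2\log_2(4/3)}\,k^2,$$ the random graph $G\sim\mathbb{G}(n,1/2)$ satisfies $$\Pr\big[G\text{ is }k\text{-vertex-minor universal}\big]\ \ge\ 1-2^{-(1+\delta(k))\,c\,k^2/2}.$$ In particular (taking $c=c_0$), for each fixed $c>0$ the probability is at least $1-2^{-(1+o(1))ck^2/2}$, where $o(1)\to 0$ as $k\to\infty$,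 uniformly in $n$. -/

import Mathlib

open Filter Topology

namespace VertexMinor

/-- The local complementation `G * v`: the subgraph of `G` induced on the neighbourhood of `v` is
replaced by its complement, and all other adjacencies are kept. -/
def localComplement {V : Type*} (G : SimpleGraph V) (v : V) : SimpleGraph V where
  Adj a b := a ≠ b ∧ Xor (G.Adj a b) (G.Adj v a ∧ G.Adj v b)
  symm := ⟨fun a b h => by
    simpa only [ne_comm (a := b), G.adj_comm b a, and_comm (a := G.Adj v b)] using h⟩
  loopless := ⟨fun _ h => h.1 rfl⟩

/-- `IsVertexMinor G S H`: the graph `H`, whose vertex set is the set `S` of vertices of `G`, can be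
obtained from `G` through a sequence of local complementations and vertex deletions. -/
inductive IsVertexMinor {V : Type*} (G : SimpleGraph V) :
    (S : Set V) → SimpleGraph S → Prop
  | start : IsVertexMinor G Set.univ (G.induce Set.univ)
  | localComplement {S : Set V} {H : SimpleGraph S} (v : S) (h : IsVertexMinor G S H) :
      IsVertexMinor G S (localComplement H v)
  | delete {S T : Set V} {H : SimpleGraph S} (v : S) (hT : T = S \ {(v : V)})
      (h : IsVertexMinor G S H) :
      IsVertexMinor G T (H.comap (Set.inclusion (hT.le.trans Set.sdiff_subset)))

/-- `G` is `k`-vertex-minor universal: for every set `U` of `k` vertices, every graph on exactly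
the vertex set `U` is a vertex-minor of `G`. -/
def IsUniversal {V : Type*} (k : ℕ) (G : SimpleGraph V) : Prop :=
  ∀ U : Set V, U.encard = k → ∀ H : SimpleGraph U, IsVertexMinor G U H

end VertexMinor

set_option linter.unusedSectionVars false
set_option linter.unusedVariables false

/-! Fix a `k`-set U and start from a uniformly random graph. At each of the n-k vertices outside U,
complement locally or not, by independent fair coins. Expand the indicator of a target T on U in
characters chi_B, with B a set of pairs in U. If no outcome shows T, the averaged terms with B
nonempty sum to exactly -1 (`sum_erase_eq_neg_one`), so the probability of missing T is at most the
second moment of that sum. The averaged characters are orthogonal (`sum_mul_eq_zero`), so only their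
individual second moments matter.

Each vertex multiplies such a moment by at most (1+2^(-r))/2, where 2r is at most the rank over F_2
of the adjacency matrix of B (`sum_avg_chi_sq_le`, `sqrt_kerDensity_le`). Every nonempty B has rank
at least 2, giving 3/4; rank at least 6 gives 9/16 = (3/4)^2; at most 2^(10k) sets B have rank at
most 5. With Q = 2^(k choose 2) (3/4)^(n-k), a union bound over T gives 2^(10k) Q + Q^2. The main
term of log_2 Q is k^2/2 - n log_2(4/3), whence the threshold; the choice of U costs only a factor
n^k. -/

namespace VertexMinor

/-! ### Local complementation and characters over F_2 -/

section Fourier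

variable {V : Type*} [Fintype V] [DecidableEq V]

/-- The nontrivial real character of `ZMod 2`. -/
def sgn (x : ZMod 2) : ℝ := if x = 0 then 1 else -1

lemma sgn_add (x y : ZMod 2) : sgn (x + y) = sgn x * sgn y := by
  have h : ∀ z : ZMod 2, z = 0 ∨ z = 1 := by decide
  have h2 : (1 : ZMod 2) + 1 = 0 := by decide
  rcases h x with rfl | rfl <;> rcases h y with rfl | rfl <;> simp [sgn, h2]

@[simp] lemma sgn_zero : sgn 0 = 1 := by simp [sgn]

@[simp] lemma sgn_one : sgn 1 = -1 := by simp [sgn]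

lemma sgn_mul_self (x : ZMod 2) : sgn x * sgn x = 1 := by
  rw [← sgn_add, CharTwo.add_self_eq_zero, sgn_zero]

/-- The neighbourhood of `v`, as a vector, in the graph with adjacency vector `a`. The values of
`a` at loops are irrelevant. -/
def nbr (v : V) (a : Sym2 V → ZMod 2) : V → ZMod 2 := fun x => if x = v then 0 else a s(v, x)

/-- The adjacency vector of the complete graph on the set with indicator vector `n`. -/
def sq (n : V → ZMod 2) : Sym2 V → ZMod 2 :=
  Sym2.lift ⟨fun x y => n x * n y, fun x y => mul_comm _ _⟩

/-- The polarization of `sq`. -/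
def cross (n h : V → ZMod 2) : Sym2 V → ZMod 2 :=
  Sym2.lift ⟨fun x y => n x * h y + n y * h x, fun x y => add_comm _ _⟩

/-- Local complementation on adjacency vectors. -/
def lc (v : V) (a : Sym2 V → ZMod 2) : Sym2 V → ZMod 2 := a + sq (nbr v a)

/-- The star with centre `v` and leaves given by `u`. -/
def star (v : V) (u : V → ZMod 2) : Sym2 V → ZMod 2 := cross (Pi.single v 1) u

@[simp] lemma sq_mk (n : V → ZMod 2) (x y : V) : sq n s(x, y) = n x * n y := rfl

@[simp] lemma cross_mk (n h : V → ZMod 2) (x y : V) :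
    cross n h s(x, y) = n x * h y + n y * h x := rfl

lemma sq_add (n h : V → ZMod 2) : sq (n + h) = sq n + sq h + cross n h := by
  funext e
  induction e with | _ x y => simp; ring

lemma cross_add_right (n h h' : V → ZMod 2) : cross n (h + h') = cross n h + cross n h' := by
  funext e
  induction e with | _ x y => simp; ring

lemma cross_add_left (n n' h : V → ZMod 2) : cross (n + n') h = cross n h + cross n' h := by
  funext e
  induction e with | _ x y => simp; ring

lemma nbr_self (v : V) (a : Sym2 V → ZMod 2) : nbr v a v = 0 := by simp [nbr]

lemma nbr_add (v : V) (a b : Sym2 V → ZMod 2) : nbr v (a + b) = nbr v a + nbr v b := by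
  funext x
  by_cases h : x = v <;> simp [nbr, h]

lemma nbr_sq {v : V} {n : V → ZMod 2} (h : n v = 0) : nbr v (sq n) = 0 := by
  funext x
  simp [nbr, h]

lemma nbr_cross {v : V} {n u : V → ZMod 2} (h : n v = 0) (hu : u v = 0) :
    nbr v (cross n u) = 0 := by
  funext x
  simp [nbr, h, hu]

lemma nbr_star {v : V} {u : V → ZMod 2} (hu : u v = 0) : nbr v (star v u) = u := by
  funext x
  by_cases h : x = v
  · simp [nbr, h, hu]
  · simp [nbr, star, h]

lemma add_self_eq_zero' {ι : Type*} (a : ι → ZMod 2) : a + a = 0 := by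
  funext x
  exact CharTwo.add_self_eq_zero _

/-- Translation by a vector depending only on an invariant of the translation is an involution. -/
lemma sum_comp_add {ι : Type*} [Fintype ι] [DecidableEq ι] (f : (ι → ZMod 2) → ι → ZMod 2)
    (hf : ∀ a, f (a + f a) = f a) (g : (ι → ZMod 2) → ℝ) :
    ∑ a, g (a + f a) = ∑ a, g a := by
  have hinv : Function.Involutive fun a => a + f a := by
    intro a
    simp only [hf, add_assoc, add_self_eq_zero', add_zero]
  exact Equiv.sum_comp hinv.toPerm g

/-- Complementing at `v` fixes the neighbourhood of `v`, so it is an involution and preserves the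
uniform measure. -/
lemma sum_comp_lc (v : V) (g : (Sym2 V → ZMod 2) → ℝ) : ∑ a, g (lc v a) = ∑ a, g a :=
  sum_comp_add (fun a => sq (nbr v a))
    (fun a => by rw [nbr_add, nbr_sq (nbr_self v a), add_zero]) g

/-- The average of `φ` over all results of applying, for each vertex of the list in turn, either
the local complementation at this vertex or nothing. -/
noncomputable def avg : List V → ((Sym2 V → ZMod 2) → ℝ) → (Sym2 V → ZMod 2) → ℝ
  | [], φ, a => φ a
  | v :: l, φ, a => (avg l φ a + avg l φ (lc v a)) / 2

/-- The character of the space of adjacency vectors given by a set of pairs in `U`. -/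
noncomputable def chi {U : Finset V} (B : Finset (Sym2 U)) (a : Sym2 V → ZMod 2) : ℝ :=
  ∏ e ∈ B, sgn (a (e.map (↑)))

variable {U : Finset V} (B : Finset (Sym2 U))

lemma chi_add (a b : Sym2 V → ZMod 2) : chi B (a + b) = chi B a * chi B b := by
  simp [chi, sgn_add, Finset.prod_mul_distrib]

lemma chi_mul_self (a : Sym2 V → ZMod 2) : chi B a * chi B a = 1 := by
  rw [chi, ← Finset.prod_mul_distrib]
  exact Finset.prod_eq_one fun e _ => sgn_mul_self _

lemma chi_eq_one_or (a : Sym2 V → ZMod 2) : chi B a = 1 ∨ chi B a = -1 :=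
  mul_self_eq_one_iff.mp (chi_mul_self B a)

/-- Neighbourhoods of vertices outside `U` ignore pairs inside `U`, so the perturbation passes
unchanged to the final character. -/
lemma avg_chi_add_of_inside {l : List V} (hl : ∀ v ∈ l, v ∉ U) {e : Sym2 V → ZMod 2}
    (he : ∀ x y, x ∉ U → e s(x, y) = 0) (a : Sym2 V → ZMod 2) :
    avg l (chi B) (a + e) = chi B e * avg l (chi B) a := by
  induction l generalizing a with
  | nil => simp [avg, chi_add, mul_comm]
  | cons v l ih =>
    have hv : v ∉ U := hl v (by simp)
    have h0 : nbr v e = 0 := by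
      funext x
      simp [nbr, he v x hv]
    have h1 : lc v (a + e) = lc v a + e := by
      rw [lc, nbr_add, h0, add_zero, lc]
      abel
    have ih' := ih fun w hw => hl w (by simp [hw])
    simp only [avg, h1, ih']
    ring

/-- Complementing at w ≠ v sees the perturbation only in coordinate `v` of its neighbourhood, so the
difference stays on pairs through `v`, which characters of `U` never read. -/
lemma avg_chi_add_of_at {l : List V} {v : V} (hvU : v ∉ U) (hvl : v ∉ l)
    {e : Sym2 V → ZMod 2} (he : ∀ x y, x ≠ v → y ≠ v → e s(x, y) = 0) (a : Sym2 V → ZMod 2) :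
    avg l (chi B) (a + e) = avg l (chi B) a := by
  induction l generalizing a e with
  | nil =>
    simp only [avg, chi]
    refine Finset.prod_congr rfl fun z _ => ?_
    induction z with
    | _ x y =>
      have hx : (x : V) ≠ v := fun h => hvU (h ▸ x.2)
      have hy : (y : V) ≠ v := fun h => hvU (h ▸ y.2)
      simp [he x y hx hy]
  | cons w l ih =>
    have hw : w ≠ v := fun h => hvl (by simp [h])
    have hvl' : v ∉ l := fun h => hvl (by simp [h])
    have h1 : lc w (a + e) = lc w a + (e + sq (nbr w e) + cross (nbr w a) (nbr w e)) := by
      rw [lc, nbr_add, sq_add, lc]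
      abel
    have hn : ∀ x, x ≠ v → nbr w e x = 0 := by
      intro x hx
      simp [nbr, he w x hw hx]
    simp only [avg, h1]
    rw [ih hvl' he, ih hvl']
    intro x y hx hy
    simp [he x y hx hy, hn x hx, hn y hy]

/-- Extension by zero of a vector indexed by `U`. -/
def ext (u : U → ZMod 2) : V → ZMod 2 := fun x => if h : x ∈ U then u ⟨x, h⟩ else 0

lemma ext_add (u u' : U → ZMod 2) : ext (u + u') = ext u + ext u' := by
  funext x
  by_cases h : x ∈ U <;> simp [ext, h]

lemma ext_of_notMem (u : U → ZMod 2) {v : V} (hv : v ∉ U) : ext u v = 0 := by simp [ext, hv]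

@[simp] lemma ext_coe (u : U → ZMod 2) (x : U) : ext u x = u x := by simp [ext]

/-- The kernel of the alternating form on `U → ZMod 2` given by the set of pairs `B`. -/
noncomputable def formKer : Finset (U → ZMod 2) :=
  open Classical in {h | ∀ u : U → ZMod 2, chi B (cross (ext u) (ext h)) = 1}

lemma sum_chi_cross (h : U → ZMod 2) :
    ∑ u : U → ZMod 2, chi B (cross (ext u) (ext h)) =
      if h ∈ formKer B then (Fintype.card (U → ZMod 2) : ℝ) else 0 := by
  split_ifs with hh
  · rw [formKer, Finset.mem_filter] at hh
    simp [hh.2]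
  · simp only [formKer, Finset.mem_filter, Finset.mem_univ, true_and, not_forall] at hh
    obtain ⟨u₀, hu₀⟩ := hh
    have h1 := (chi_eq_one_or B (cross (ext u₀) (ext h))).resolve_left hu₀
    have h2 : ∑ u : U → ZMod 2, chi B (cross (ext (u + u₀)) (ext h)) =
        ∑ u : U → ZMod 2, chi B (cross (ext u) (ext h)) :=
      sum_comp_add (fun _ => u₀) (fun _ => rfl) (fun u => chi B (cross (ext u) (ext h)))
    simp only [ext_add, cross_add_left, chi_add, h1, ← Finset.sum_mul] at h2
    linarith

/-! ### Decay of the second moment, one vertex at a time -/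

section Decay

variable {l : List V} {v : V}

lemma sum_mul_shift_le (F : (Sym2 V → ZMod 2) → ℝ) (f : (Sym2 V → ZMod 2) → Sym2 V → ZMod 2)
    (hf : ∀ a, f (a + f a) = f a) : |∑ a, F a * F (a + f a)| ≤ ∑ a, F a ^ 2 := by
  calc |∑ a, F a * F (a + f a)| ≤ ∑ a, |F a * F (a + f a)| := Finset.abs_sum_le_sum_abs _ _
    _ ≤ ∑ a, (F a ^ 2 + F (a + f a) ^ 2) / 2 := by
      refine Finset.sum_le_sum fun a _ => ?_
      rw [abs_le]
      constructor <;> nlinarith [sq_nonneg (F a - F (a + f a)), sq_nonneg (F a + F (a + f a))]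
    _ = ∑ a, F a ^ 2 := by
      rw [← Finset.sum_div, Finset.sum_add_distrib, sum_comp_add f hf fun a => F a ^ 2]
      ring

/-- Adding a star at `v` is invisible to `avg l (chi B)` but shifts the neighbourhood of `v` by `u`.
Complementation then produces a sign from `sq (ext u)` and a cross term, with `u` free to be
averaged over. -/
lemma sum_mul_lc_eq (hl : ∀ v ∈ l, v ∉ U) (hvU : v ∉ U) (hvl : v ∉ l) (u : U → ZMod 2) :
    ∑ a, avg l (chi B) a * avg l (chi B) (lc v a) =
      ∑ a, avg l (chi B) a * (chi B (sq (ext u)) *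
        avg l (chi B) (a + (sq (nbr v a) + cross (nbr v a) (ext u)))) := by
  have huv := ext_of_notMem u hvU
  rw [← sum_comp_add (fun _ => star v (ext u)) (fun _ => rfl)]
  have hstar : ∀ x y, x ≠ v → y ≠ v → star v (ext u) s(x, y) = 0 := by
    intro x y hx hy
    simp [star, hx, hy]
  refine Finset.sum_congr rfl fun a _ => ?_
  rw [avg_chi_add_of_at B hvU hvl hstar]
  congr 1
  have h1 : lc v (a + star v (ext u)) =
      a + (sq (nbr v a) + cross (nbr v a) (ext u)) + sq (ext u) + star v (ext u) := by
    rw [lc, nbr_add, nbr_star huv, sq_add]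
    abel
  rw [h1, avg_chi_add_of_at B hvU hvl hstar, avg_chi_add_of_inside B hl]
  intro x y hx
  simp [ext_of_notMem u hx]

/-- Expand the square over pairs u, u+h. The correlation of the two translates depends only on h,
and the signs leave a character of u that sums to zero unless h lies in the kernel. -/
lemma sum_sq_sum_le (hvU : v ∉ U) (F : (Sym2 V → ZMod 2) → ℝ) :
    ∑ a, (∑ u : U → ZMod 2, chi B (sq (ext u)) *
        F (a + (sq (nbr v a) + cross (nbr v a) (ext u)))) ^ 2 ≤
      Fintype.card (U → ZMod 2) * (formKer B).card * ∑ a, F a ^ 2 := by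
  set τ : (U → ZMod 2) → (Sym2 V → ZMod 2) → Sym2 V → ZMod 2 :=
    fun u a => sq (nbr v a) + cross (nbr v a) (ext u) with hτ
  have hnτ : ∀ u a, nbr v (a + τ u a) = nbr v a := fun u a => by
    rw [nbr_add, hτ]
    simp only
    rw [nbr_add, nbr_sq (nbr_self v a), nbr_cross (nbr_self v a) (ext_of_notMem u hvU)]
    simp
  have hτc : ∀ u a b, nbr v a = nbr v b → τ u a = τ u b := fun u a b hab => by
    simp only [hτ, hab]
  have hnc : ∀ (h : U → ZMod 2) a, nbr v (a + cross (nbr v a) (ext h)) = nbr v a := fun h a => by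
    rw [nbr_add, nbr_cross (nbr_self v a) (ext_of_notMem h hvU), add_zero]
  set T : (U → ZMod 2) → ℝ := fun h => ∑ a, F a * F (a + cross (nbr v a) (ext h)) with hT
  have hTle : ∀ h, |T h| ≤ ∑ a, F a ^ 2 := fun h =>
    sum_mul_shift_le F (fun a => cross (nbr v a) (ext h)) fun a => by rw [hnc]
  -- Translation by `τ u` preserves the neighbourhood of `v`, hence is a bijection that removes `u`.
  have hcorr : ∀ u h, ∑ a, F (a + τ u a) * F (a + τ (u + h) a) = T h := by
    intro u h
    rw [hT]
    simp only
    rw [← sum_comp_add (τ u) (fun a => hτc u _ _ (hnτ u a))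
      (fun a => F a * F (a + cross (nbr v a) (ext h)))]
    refine Finset.sum_congr rfl fun a _ => ?_
    rw [hnτ]
    congr 2
    simp only [hτ, ext_add, cross_add_right]
    abel
  have hsign : ∀ u h : U → ZMod 2, chi B (sq (ext u)) * chi B (sq (ext (u + h))) =
      chi B (sq (ext h)) * chi B (cross (ext u) (ext h)) := by
    intro u h
    rw [ext_add, sq_add, chi_add, chi_add]
    linear_combination (chi B (sq (ext h)) * chi B (cross (ext u) (ext h))) *
      chi_mul_self B (sq (ext u))
  calc ∑ a, (∑ u, chi B (sq (ext u)) * F (a + τ u a)) ^ 2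
      = ∑ a, ∑ u, ∑ u', (chi B (sq (ext u)) * F (a + τ u a)) *
          (chi B (sq (ext u')) * F (a + τ u' a)) := by
        refine Finset.sum_congr rfl fun a _ => ?_
        rw [pow_two, Finset.sum_mul_sum]
    _ = ∑ u, ∑ u', ∑ a, (chi B (sq (ext u)) * F (a + τ u a)) *
          (chi B (sq (ext u')) * F (a + τ u' a)) := by
        rw [Finset.sum_comm]
        refine Finset.sum_congr rfl fun u _ => ?_
        rw [Finset.sum_comm]
    _ = ∑ u, ∑ h, ∑ a, (chi B (sq (ext u)) * F (a + τ u a)) *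
          (chi B (sq (ext (u + h))) * F (a + τ (u + h) a)) := by
        refine Finset.sum_congr rfl fun u _ => ?_
        exact (Equiv.sum_comp (Equiv.addLeft u) fun u' => ∑ a, (chi B (sq (ext u)) *
          F (a + τ u a)) * (chi B (sq (ext u')) * F (a + τ u' a))).symm
    _ = ∑ u, ∑ h, chi B (sq (ext h)) * chi B (cross (ext u) (ext h)) * T h := by
        refine Finset.sum_congr rfl fun u _ => Finset.sum_congr rfl fun h _ => ?_
        rw [← hsign, ← hcorr u h, Finset.mul_sum]
        exact Finset.sum_congr rfl fun a _ => by ring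
    _ = ∑ h, chi B (sq (ext h)) * T h * ∑ u, chi B (cross (ext u) (ext h)) := by
        rw [Finset.sum_comm]
        refine Finset.sum_congr rfl fun h _ => ?_
        rw [Finset.mul_sum]
        exact Finset.sum_congr rfl fun a _ => by ring
    _ ≤ ∑ h, if h ∈ formKer B then
          (Fintype.card (U → ZMod 2) : ℝ) * ∑ a, F a ^ 2 else 0 := by
        refine Finset.sum_le_sum fun h _ => ?_
        rw [sum_chi_cross]
        split_ifs with hh
        · rw [mul_comm]
          refine mul_le_mul_of_nonneg_left ?_ (Nat.cast_nonneg _)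
          refine le_trans (le_abs_self _) ?_
          rw [abs_mul]
          rcases chi_eq_one_or B (sq (ext h)) with hc | hc <;> simpa [hc, hT] using hTle h
        · simp
    _ = _ := by
        rw [Finset.sum_ite_mem, Finset.univ_inter, Finset.sum_const, nsmul_eq_mul]
        ring

/-- The density of the kernel, whose square root governs the decay of the Fourier coefficient. -/
noncomputable def kerDensity : ℝ := (formKer B).card / Fintype.card (U → ZMod 2)

/-- Average `sum_mul_lc_eq` over `u` and apply Cauchy–Schwarz, the source of the square root. -/
lemma sum_mul_lc_le (hl : ∀ v ∈ l, v ∉ U) (hvU : v ∉ U) (hvl : v ∉ l) :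
    ∑ a, avg l (chi B) a * avg l (chi B) (lc v a) ≤
      √(kerDensity B) * ∑ a, avg l (chi B) a ^ 2 := by
  set F := avg l (chi B) with hF
  set N : ℝ := (Fintype.card (U → ZMod 2) : ℝ) with hN
  have hNpos : 0 < N := by rw [hN]; exact_mod_cast Fintype.card_pos
  set S := ∑ a, F a * F (lc v a)
  set Q := ∑ a, F a ^ 2 with hQ
  have hQ0 : 0 ≤ Q := Finset.sum_nonneg fun a _ => sq_nonneg _
  have h1 : N * S = ∑ a, F a * ∑ u : U → ZMod 2, chi B (sq (ext u)) *
        F (a + (sq (nbr v a) + cross (nbr v a) (ext u))) := by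
    simp only [Finset.mul_sum]
    rw [Finset.sum_comm, ← Finset.sum_congr rfl fun u _ => sum_mul_lc_eq B hl hvU hvl u]
    simp [hN, S, hF]
  have h2 : (N * S) ^ 2 ≤ Q * (N * (formKer B).card * Q) := by
    rw [h1]
    refine (Finset.sum_mul_sq_le_sq_mul_sq _ _ _).trans ?_
    exact mul_le_mul_of_nonneg_left (sum_sq_sum_le B hvU F) hQ0
  have h3 : S ^ 2 ≤ kerDensity B * Q ^ 2 := by
    have h4 : N ^ 2 * S ^ 2 ≤ N ^ 2 * (kerDensity B * Q ^ 2) := by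
      have : N ^ 2 * (kerDensity B * Q ^ 2) = Q * (N * (formKer B).card * Q) := by
        rw [kerDensity, ← hN]
        field_simp
      rw [this]
      linarith [h2, mul_pow N S 2]
    exact le_of_mul_le_mul_left h4 (by positivity)
  refine (Real.le_sqrt_of_sq_le h3).trans_eq ?_
  rw [Real.sqrt_mul (by rw [kerDensity]; positivity), Real.sqrt_sq hQ0]

/-- The second moment of a Fourier coefficient decays exponentially in the number of processed
vertices. -/
lemma sum_avg_chi_sq_le {β : ℝ} (hβ : √(kerDensity B) ≤ β) (hl : ∀ v ∈ l, v ∉ U)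
    (hnd : l.Nodup) :
    ∑ a, avg l (chi B) a ^ 2 ≤
      ((1 + β) / 2) ^ l.length * Fintype.card (Sym2 V → ZMod 2) := by
  have hβ0 : 0 ≤ β := (Real.sqrt_nonneg _).trans hβ
  induction l with
  | nil => simp [avg, pow_two, chi_mul_self]
  | cons v l ih =>
    have hl' : ∀ w ∈ l, w ∉ U := fun w hw => hl w (by simp [hw])
    have hvU : v ∉ U := hl v (by simp)
    rw [List.nodup_cons] at hnd
    have ih' := ih hl' hnd.2
    have hc := sum_mul_lc_le B hl' hvU hnd.1
    have hQ0 : 0 ≤ ∑ a, avg l (chi B) a ^ 2 := Finset.sum_nonneg fun a _ => sq_nonneg _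
    have e1 : ∑ a, avg (v :: l) (chi B) a ^ 2 = (∑ a, avg l (chi B) a ^ 2 +
        ∑ a, avg l (chi B) (lc v a) ^ 2 +
        2 * ∑ a, avg l (chi B) a * avg l (chi B) (lc v a)) / 4 := by
      rw [Finset.mul_sum, ← Finset.sum_add_distrib, ← Finset.sum_add_distrib, Finset.sum_div]
      refine Finset.sum_congr rfl fun a _ => ?_
      rw [avg]
      ring
    rw [e1, sum_comp_lc v fun a => avg l (chi B) a ^ 2, List.length_cons, pow_succ]
    have h5 := mul_le_mul_of_nonneg_right hβ hQ0
    have h6 := mul_le_mul_of_nonneg_left ih' (show 0 ≤ (1 + β) / 2 by positivity)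
    linarith

end Decay

end Fourier

/-! ### Counting matrices of bounded rank -/

section Rank

/-- Factor through the column space, embedded in K^r. -/
lemma exists_eq_mul_of_rank_le {K m n : Type*} [Field K] [Fintype m] [Fintype n] [DecidableEq m]
    [DecidableEq n] {r : ℕ} (M : Matrix m n K) (h : M.rank ≤ r) :
    ∃ (X : Matrix m (Fin r) K) (Y : Matrix (Fin r) n K), M = X * Y := by
  have h' : Module.finrank K (LinearMap.range M.mulVecLin) ≤ Module.finrank K (Fin r → K) := by
    rw [Module.finrank_fin_fun]
    exact h
  obtain ⟨f, hf⟩ := finrank_le_iff_exists_linearMap.mp h'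
  obtain ⟨g, hg⟩ := f.exists_leftInverse_of_injective (LinearMap.ker_eq_bot.mpr hf)
  refine ⟨LinearMap.toMatrix' ((LinearMap.range M.mulVecLin).subtype ∘ₗ g),
    LinearMap.toMatrix' (f ∘ₗ M.mulVecLin.rangeRestrict), ?_⟩
  rw [← LinearMap.toMatrix'_comp]
  have : ((LinearMap.range M.mulVecLin).subtype ∘ₗ g) ∘ₗ (f ∘ₗ M.mulVecLin.rangeRestrict) =
      M.mulVecLin := by
    rw [LinearMap.comp_assoc, ← LinearMap.comp_assoc _ f g, hg, LinearMap.id_comp,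
      LinearMap.subtype_comp_codRestrict]
  rw [this, ← Matrix.toLin'_apply', LinearMap.toMatrix'_toLin']

lemma card_rank_le {K m n : Type*} [Field K] [Fintype K] [DecidableEq K] [Fintype m] [Fintype n]
    [DecidableEq m] [DecidableEq n] (r : ℕ) :
    (Finset.univ.filter fun M : Matrix m n K => M.rank ≤ r).card ≤
      Fintype.card K ^ (r * (Fintype.card m + Fintype.card n)) := by
  have hsub : (Finset.univ.filter fun M : Matrix m n K => M.rank ≤ r) ⊆
      Finset.univ.image fun p : Matrix m (Fin r) K × Matrix (Fin r) n K => p.1 * p.2 := by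
    intro M hM
    obtain ⟨X, Y, h⟩ := exists_eq_mul_of_rank_le M (Finset.mem_filter.mp hM).2
    exact Finset.mem_image.mpr ⟨(X, Y), Finset.mem_univ _, h.symm⟩
  refine (Finset.card_le_card hsub).trans (Finset.card_image_le.trans_eq ?_)
  have h1 : Fintype.card (Matrix m (Fin r) K) = Fintype.card (m → Fin r → K) :=
    Fintype.card_congr Matrix.of.symm
  have h2 : Fintype.card (Matrix (Fin r) n K) = Fintype.card (Fin r → n → K) :=
    Fintype.card_congr Matrix.of.symm
  rw [Finset.card_univ, Fintype.card_prod, h1, h2]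
  simp only [Fintype.card_fun, Fintype.card_fin, ← pow_mul, ← pow_add]
  congr 1
  ring

lemma card_ker_mul_pow_rank {K m n : Type*} [Field K] [Fintype K] [DecidableEq K] [Fintype m]
    [Fintype n] [DecidableEq m] [DecidableEq n] (M : Matrix m n K) :
    (Finset.univ.filter fun h : n → K => M.mulVec h = 0).card * Fintype.card K ^ M.rank =
      Fintype.card K ^ Fintype.card n := by
  classical
  have h1 : (Finset.univ.filter fun h : n → K => M.mulVec h = 0).card =
      Fintype.card (LinearMap.ker M.mulVecLin) := by
    rw [Fintype.card_subtype]
    simp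
  have h2 := LinearMap.finrank_range_add_finrank_ker M.mulVecLin
  rw [h1, Module.card_eq_pow_finrank (K := K), ← pow_add, Matrix.rank, add_comm, h2,
    Module.finrank_fintype_fun_eq_card]

end Rank

/-! ### Rank of the alternating form of B -/

section Form

variable {V : Type*} [Fintype V] [DecidableEq V] {U : Finset V} (B : Finset (Sym2 U))

/-- The adjacency matrix of the graph on `U` with edge set `B`. -/
def adjMat : Matrix U U (ZMod 2) := Matrix.of fun i j => if s(i, j) ∈ B then 1 else 0

lemma adjMat_injective : Function.Injective (adjMat : Finset (Sym2 U) → _) := by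
  intro B B' h
  ext e
  induction e with
  | _ i j =>
    have := congrFun (congrFun h i) j
    simp only [adjMat, Matrix.of_apply] at this
    by_cases h1 : s(i, j) ∈ B <;> by_cases h2 : s(i, j) ∈ B' <;> simp_all

lemma chi_eq_sgn_sum (a : Sym2 V → ZMod 2) : chi B a = sgn (∑ e ∈ B, a (e.map (↑))) := by
  classical
  induction B using Finset.induction_on with
  | empty => simp [chi]
  | insert e B he ih => rw [chi, Finset.prod_insert he, Finset.sum_insert he, sgn_add, ← ih, chi]

lemma eq_zero_of_sgn_eq_one {x : ZMod 2} (h : sgn x = 1) : x = 0 := by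
  by_contra hx
  rw [sgn, if_neg hx] at h
  norm_num at h

variable {B}

/-- Testing the form on basis vectors puts its kernel inside that of `adjMat B`. Loops are excluded
because they vanish in the form but not in the matrix. -/
lemma sum_cross_single (hB : ∀ e ∈ B, ¬ e.IsDiag) (i : U) (h : U → ZMod 2) :
    ∑ e ∈ B, cross (ext (Pi.single i 1)) (ext h) (e.map (↑)) = (adjMat B).mulVec h i := by
  have key : ∀ e ∈ B, cross (ext (Pi.single i 1)) (ext h) (e.map (↑)) =
      ∑ j, if s(i, j) = e then h j else 0 := by
    intro e he
    have hd := hB e he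
    induction e with
    | _ x y =>
      rw [Sym2.mk_isDiag_iff] at hd
      simp only [Sym2.map_mk, cross_mk, ext_coe, Sym2.eq_iff]
      by_cases hx : i = x
      · subst hx
        simp [hd, Ne.symm hd]
      · by_cases hy : i = y
        · subst hy
          simp [hx, Ne.symm hx]
        · simp [hx, hy, Ne.symm hx, Ne.symm hy]
  rw [Finset.sum_congr rfl key, Finset.sum_comm, Matrix.mulVec, dotProduct]
  refine Finset.sum_congr rfl fun j _ => ?_
  simp [adjMat]

lemma card_formKer_mul_le (hB : ∀ e ∈ B, ¬ e.IsDiag) :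
    (formKer B).card * 2 ^ (adjMat B).rank ≤ Fintype.card (U → ZMod 2) := by
  have h1 := card_ker_mul_pow_rank (adjMat B)
  rw [ZMod.card] at h1
  rw [Fintype.card_fun, ZMod.card, ← h1]
  refine Nat.mul_le_mul_right _ (Finset.card_le_card fun h hh => ?_)
  simp only [formKer, Finset.mem_filter, Finset.mem_univ, true_and] at hh ⊢
  funext i
  have := hh (Pi.single i 1)
  rw [chi_eq_sgn_sum, sum_cross_single hB] at this
  exact eq_zero_of_sgn_eq_one this

lemma sqrt_kerDensity_le (hB : ∀ e ∈ B, ¬ e.IsDiag) {r : ℕ} (hr : 2 * r ≤ (adjMat B).rank) :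
    √(kerDensity B) ≤ 1 / 2 ^ r := by
  have h1 := card_formKer_mul_le hB
  have h2 : (formKer B).card * 2 ^ (2 * r) ≤ Fintype.card (U → ZMod 2) :=
    (Nat.mul_le_mul_left _ (Nat.pow_le_pow_right two_pos hr)).trans h1
  have h3 : ((formKer B).card : ℝ) * (2 ^ r) ^ 2 ≤ Fintype.card (U → ZMod 2) := by
    rw [← pow_mul, mul_comm r 2]
    exact_mod_cast h2
  have hN : (0 : ℝ) < Fintype.card (U → ZMod 2) := by exact_mod_cast Fintype.card_pos
  rw [Real.sqrt_le_left (by positivity), kerDensity, div_pow, one_pow,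
    div_le_div_iff₀ hN (by positivity), one_mul]
  exact h3

/-- An edge gives an invertible 2 × 2 submatrix. -/
lemma two_le_rank_adjMat (hB : ∀ e ∈ B, ¬ e.IsDiag) (hne : B.Nonempty) :
    2 ≤ (adjMat B).rank := by
  obtain ⟨e, he⟩ := hne
  induction e with
  | _ i j =>
    have hii : ∀ i, s(i, i) ∉ B := fun i h => hB _ h (Sym2.mk_isDiag_iff.mpr rfl)
    have h1 : (adjMat B).submatrix ![i, j] ![i, j] = !![0, 1; 1, 0] := by
      have he' : s(j, i) ∈ B := Sym2.eq_swap ▸ he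
      ext p q
      fin_cases p <;> fin_cases q <;> simp [adjMat, hii, he, he']
    have h2 := Matrix.rank_submatrix_le (adjMat B) ![i, j] ![i, j]
    have h3 : IsUnit (!![0, 1; 1, 0] : Matrix (Fin 2) (Fin 2) (ZMod 2)) := by
      rw [Matrix.isUnit_iff_isUnit_det]
      simp [Matrix.det_fin_two]
    rwa [h1, Matrix.rank_of_isUnit _ h3, Fintype.card_fin] at h2

lemma card_rank_adjMat_le (r : ℕ) (S : Finset (Finset (Sym2 U))) :
    (S.filter fun B => (adjMat B).rank ≤ r).card ≤ 2 ^ (2 * r * U.card) := by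
  have h := card_rank_le (K := ZMod 2) (m := U) (n := U) r
  rw [ZMod.card, Fintype.card_coe, ← two_mul, ← mul_assoc, mul_comm r 2] at h
  refine le_trans (Finset.card_le_card_of_injOn adjMat ?_ adjMat_injective.injOn) h
  intro B hB
  simpa using (Finset.mem_filter.mp hB).2

end Form

/-! ### Second moment bound for missing a target -/

section SecondMoment

variable {V : Type*} [Fintype V] [DecidableEq V]

/-- `IsLeaf l a b`: the vector `b` arises from `a` by applying, for each vertex of the list in turn,
either the local complementation at this vertex or nothing. -/
def IsLeaf : List V → (Sym2 V → ZMod 2) → (Sym2 V → ZMod 2) → Prop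
  | [], a, b => b = a
  | v :: l, a, b => IsLeaf l a b ∨ IsLeaf l (lc v a) b

lemma avg_eq_zero {l : List V} {φ : (Sym2 V → ZMod 2) → ℝ} {a : Sym2 V → ZMod 2}
    (h : ∀ b, IsLeaf l a b → φ b = 0) : avg l φ a = 0 := by
  induction l generalizing a with
  | nil => exact h a rfl
  | cons v l ih =>
    rw [avg, ih fun b hb => h b (Or.inl hb), ih fun b hb => h b (Or.inr hb)]
    norm_num

lemma avg_const (l : List V) (c : ℝ) (a : Sym2 V → ZMod 2) : avg l (fun _ => c) a = c := by
  induction l generalizing a with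
  | nil => rfl
  | cons v l ih =>
    rw [avg, ih, ih]
    ring

lemma avg_sum {ι : Type*} (l : List V) (s : Finset ι) (c : ι → ℝ)
    (φ : ι → (Sym2 V → ZMod 2) → ℝ) (a : Sym2 V → ZMod 2) :
    avg l (fun b => ∑ i ∈ s, c i * φ i b) a = ∑ i ∈ s, c i * avg l (φ i) a := by
  induction l generalizing a with
  | nil => rfl
  | cons v l ih =>
    simp only [avg]
    rw [ih, ih, ← Finset.sum_add_distrib, Finset.sum_div]
    exact Finset.sum_congr rfl fun i _ => by ring

variable {U : Finset V}

/-- The pairs of distinct elements of `U`. -/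
def pairs (U : Finset V) : Finset (Sym2 U) := Finset.univ.filter fun e => ¬ e.IsDiag

lemma card_pairs (U : Finset V) : (pairs U).card = U.card.choose 2 := by
  rw [← Fintype.card_coe U, ← SimpleGraph.card_edgeFinset_top_eq_card_choose_two]
  congr 1
  ext e
  induction e with | _ x y => simp [pairs]

/-- The graph on `U` with adjacency vector `b` has edge set `T`. -/
def HasPattern (T : Finset (Sym2 U)) (b : Sym2 V → ZMod 2) : Prop :=
  ∀ e ∈ pairs U, b (e.map (↑)) = 1 ↔ e ∈ T

/-- The sign with which the character of `B` enters the indicator function of the pattern `T`. -/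
noncomputable def patternSign (T B : Finset (Sym2 U)) : ℝ := ∏ e ∈ B, if e ∈ T then -1 else 1

lemma patternSign_sq (T B : Finset (Sym2 U)) : patternSign T B ^ 2 = 1 := by
  rw [patternSign, ← Finset.prod_pow]
  refine Finset.prod_eq_one fun e _ => ?_
  split_ifs <;> norm_num

/-- The sum factors over pairs e as 1 ± sgn(b e); a pair where `b` and `T` disagree gives a zero
factor. -/
lemma sum_patternSign_mul_chi {T : Finset (Sym2 U)} {b : Sym2 V → ZMod 2}
    (h : ¬ HasPattern T b) : ∑ B ∈ (pairs U).powerset, patternSign T B * chi B b = 0 := by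
  simp only [patternSign, chi, ← Finset.prod_mul_distrib]
  rw [← Finset.prod_one_add]
  simp only [HasPattern, not_forall] at h
  obtain ⟨e, he, hne⟩ := h
  refine Finset.prod_eq_zero he ?_
  have h01 : ∀ z : ZMod 2, z = 0 ∨ z = 1 := by decide
  rcases h01 (b (e.map (↑))) with h0 | h0 <;> by_cases hT : e ∈ T <;> simp_all

lemma sum_erase_eq_neg_one {l : List V} {T : Finset (Sym2 U)} {a : Sym2 V → ZMod 2}
    (h : ∀ b, IsLeaf l a b → ¬ HasPattern T b) :
    ∑ B ∈ (pairs U).powerset.erase ∅, patternSign T B * avg l (chi B) a = -1 := by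
  have h1 := avg_eq_zero fun b hb => sum_patternSign_mul_chi (h b hb)
  rw [avg_sum, ← Finset.add_sum_erase _ _ (Finset.empty_mem_powerset (pairs U))] at h1
  have h2 : avg l (chi (∅ : Finset (Sym2 U))) a = 1 := by
    have : (chi (∅ : Finset (Sym2 U)) : (Sym2 V → ZMod 2) → ℝ) = fun _ => 1 := by
      funext b
      simp [chi]
    rw [this, avg_const]
  rw [h2, patternSign, Finset.prod_empty] at h1
  linarith

lemma chi_single (B : Finset (Sym2 U)) (e : Sym2 U) :
    chi B (Pi.single (e.map (↑) : Sym2 V) 1) = if e ∈ B then -1 else 1 := by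
  have hinj : ∀ e' : Sym2 U, e'.map ((↑) : U → V) = e.map (↑) ↔ e' = e := fun e' =>
    (Sym2.map.injective Subtype.val_injective).eq_iff
  rw [chi, ← Finset.prod_ite_eq' B e fun _ => (-1 : ℝ)]
  refine Finset.prod_congr rfl fun e' _ => ?_
  by_cases h : e' = e
  · simp [h]
  · simp [hinj, h]

/-- Flipping a pair in exactly one of `B`, `B'` preserves the measure and negates the product. -/
lemma sum_mul_eq_zero {l : List V} (hl : ∀ v ∈ l, v ∉ U) {B B' : Finset (Sym2 U)} (h : B ≠ B') :
    ∑ a, avg l (chi B) a * avg l (chi B') a = 0 := by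
  obtain ⟨e, he⟩ : ∃ e, ¬ (e ∈ B ↔ e ∈ B') := by
    by_contra hcon
    push Not at hcon
    exact h (Finset.ext hcon)
  have hin : ∀ x y, x ∉ U → (Pi.single (e.map (↑) : Sym2 V) 1 : Sym2 V → ZMod 2) s(x, y) = 0 := by
    intro x y hx
    refine Pi.single_eq_of_ne ?_ _
    intro heq
    have hmem : x ∈ e.map ((↑) : U → V) := heq ▸ Sym2.mem_mk_left x y
    obtain ⟨z, _, rfl⟩ := Sym2.mem_map.mp hmem
    exact hx z.2
  have h1 := sum_comp_add (fun _ => Pi.single (e.map (↑) : Sym2 V) 1) (fun _ => rfl)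
    fun a => avg l (chi B) a * avg l (chi B') a
  simp only [avg_chi_add_of_inside _ hl hin, chi_single] at h1
  have h2 : ∀ a, (if e ∈ B then (-1 : ℝ) else 1) * avg l (chi B) a *
      ((if e ∈ B' then (-1 : ℝ) else 1) * avg l (chi B') a) =
      - (avg l (chi B) a * avg l (chi B') a) := by
    intro a
    by_cases h3 : e ∈ B <;> by_cases h4 : e ∈ B' <;> simp_all
  rw [Finset.sum_congr rfl fun a _ => h2 a, Finset.sum_neg_distrib] at h1
  linarith

lemma sum_sq_eq {l : List V} (hl : ∀ v ∈ l, v ∉ U) (T : Finset (Sym2 U))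
    (S : Finset (Finset (Sym2 U))) :
    ∑ a, (∑ B ∈ S, patternSign T B * avg l (chi B) a) ^ 2 =
      ∑ B ∈ S, ∑ a, avg l (chi B) a ^ 2 := by
  calc ∑ a, (∑ B ∈ S, patternSign T B * avg l (chi B) a) ^ 2
      = ∑ B ∈ S, ∑ B' ∈ S, ∑ a, (patternSign T B * avg l (chi B) a) *
          (patternSign T B' * avg l (chi B') a) := by
        simp only [pow_two, Finset.sum_mul_sum]
        rw [Finset.sum_comm]
        exact Finset.sum_congr rfl fun B _ => Finset.sum_comm
    _ = ∑ B ∈ S, ∑ B' ∈ S, patternSign T B * patternSign T B' *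
          ∑ a, avg l (chi B) a * avg l (chi B') a := by
        refine Finset.sum_congr rfl fun B _ => Finset.sum_congr rfl fun B' _ => ?_
        rw [Finset.mul_sum]
        exact Finset.sum_congr rfl fun a _ => by ring
    _ = ∑ B ∈ S, ∑ a, avg l (chi B) a ^ 2 := by
        refine Finset.sum_congr rfl fun B hB => ?_
        rw [Finset.sum_eq_single_of_mem B hB]
        · rw [← pow_two, patternSign_sq, one_mul]
          exact Finset.sum_congr rfl fun a _ => (pow_two _).symm
        · intro B' _ hne
          rw [sum_mul_eq_zero hl hne.symm, mul_zero]

lemma sum_sum_avg_chi_sq_le {l : List V} (hl : ∀ v ∈ l, v ∉ U) (hnd : l.Nodup) :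
    ∑ B ∈ (pairs U).powerset.erase ∅, ∑ a, avg l (chi B) a ^ 2 ≤
      (2 ^ (10 * U.card) * (3 / 4) ^ l.length + 2 ^ (U.card.choose 2) * (9 / 16) ^ l.length) *
        Fintype.card (Sym2 V → ZMod 2) := by
  set S := (pairs U).powerset.erase ∅ with hS
  set N : ℝ := (Fintype.card (Sym2 V → ZMod 2) : ℝ) with hN
  have hdiag : ∀ B ∈ S, ∀ e ∈ B, ¬ e.IsDiag := by
    intro B hB e he
    have h1 := Finset.mem_powerset.mp (Finset.mem_of_mem_erase hB) he
    exact (Finset.mem_filter.mp h1).2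
  -- Rank at least 6 allows β = 1/8, and (1 + 1/8)/2 = 9/16 = (3/4)^2, enough to absorb all 2^(k
  -- choose 2) sets.
  rw [← Finset.sum_filter_add_sum_filter_not S fun B => (adjMat B).rank ≤ 5, add_mul]
  refine add_le_add ?_ ?_
  · have h1 : ∀ B ∈ S.filter fun B => (adjMat B).rank ≤ 5,
        ∑ a, avg l (chi B) a ^ 2 ≤ (3 / 4) ^ l.length * N := by
      intro B hB
      have hBS := (Finset.mem_filter.mp hB).1
      have h2 := two_le_rank_adjMat (hdiag B hBS)
        (Finset.nonempty_iff_ne_empty.mpr (Finset.ne_of_mem_erase hBS))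
      have h3 := sum_avg_chi_sq_le B (sqrt_kerDensity_le (r := 1) (hdiag B hBS) h2) hl hnd
      norm_num at h3
      simpa [hN] using h3
    refine (Finset.sum_le_card_nsmul _ _ _ h1).trans ?_
    rw [nsmul_eq_mul, ← mul_assoc]
    have h4 := card_rank_adjMat_le 5 S
    have h5 : ((S.filter fun B => (adjMat B).rank ≤ 5).card : ℝ) ≤ 2 ^ (10 * U.card) := by
      exact_mod_cast h4
    gcongr
  · have h1 : ∀ B ∈ S.filter fun B => ¬ (adjMat B).rank ≤ 5,
        ∑ a, avg l (chi B) a ^ 2 ≤ (9 / 16) ^ l.length * N := by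
      intro B hB
      obtain ⟨hBS, hr⟩ := Finset.mem_filter.mp hB
      have h3 := sum_avg_chi_sq_le B
        (sqrt_kerDensity_le (r := 3) (hdiag B hBS) (by omega)) hl hnd
      norm_num at h3
      simpa [hN] using h3
    refine (Finset.sum_le_card_nsmul _ _ _ h1).trans ?_
    rw [nsmul_eq_mul, ← mul_assoc]
    have h4 : (S.filter fun B => ¬ (adjMat B).rank ≤ 5).card ≤ 2 ^ (U.card.choose 2) := by
      refine (Finset.card_filter_le _ _).trans ((Finset.card_le_card
        (Finset.erase_subset _ _)).trans_eq ?_)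
      rw [Finset.card_powerset, card_pairs]
    have h5 : ((S.filter fun B => ¬ (adjMat B).rank ≤ 5).card : ℝ) ≤ 2 ^ (U.card.choose 2) := by
      exact_mod_cast h4
    gcongr

open Classical in
lemma card_missing_le {l : List V} (hl : ∀ v ∈ l, v ∉ U) (hnd : l.Nodup) (T : Finset (Sym2 U)) :
    ((Finset.univ.filter fun a => ∀ b, IsLeaf l a b → ¬ HasPattern T b).card : ℝ) ≤
      (2 ^ (10 * U.card) * (3 / 4) ^ l.length + 2 ^ (U.card.choose 2) * (9 / 16) ^ l.length) *
        Fintype.card (Sym2 V → ZMod 2) := by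
  refine le_trans ?_ (sum_sum_avg_chi_sq_le hl hnd)
  rw [← sum_sq_eq hl T, Finset.card_filter, Nat.cast_sum]
  refine Finset.sum_le_sum fun a _ => ?_
  split_ifs with h
  · rw [sum_erase_eq_neg_one h]
    norm_num
  · simpa using sq_nonneg _

open Classical in
/-- Few adjacency vectors fail to reach all the graphs on `U` by local complementations outside
`U`. -/
lemma card_exists_missing_le {l : List V} (hl : ∀ v ∈ l, v ∉ U) (hnd : l.Nodup) :
    ((Finset.univ.filter fun a => ∃ T : Finset (Sym2 U), T ⊆ pairs U ∧
        ∀ b, IsLeaf l a b → ¬ HasPattern T b).card : ℝ) ≤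
      2 ^ (U.card.choose 2) * ((2 ^ (10 * U.card) * (3 / 4) ^ l.length +
        2 ^ (U.card.choose 2) * (9 / 16) ^ l.length) * Fintype.card (Sym2 V → ZMod 2)) := by
  have hsub : (Finset.univ.filter fun a => ∃ T : Finset (Sym2 U), T ⊆ pairs U ∧
      ∀ b, IsLeaf l a b → ¬ HasPattern T b) ⊆ (pairs U).powerset.biUnion fun T =>
        Finset.univ.filter fun a => ∀ b, IsLeaf l a b → ¬ HasPattern T b := by
    intro a ha
    obtain ⟨T, hT, h⟩ := (Finset.mem_filter.mp ha).2
    exact Finset.mem_biUnion.mpr ⟨T, Finset.mem_powerset.mpr hT, by simpa using h⟩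
  have h1 := (Finset.card_le_card hsub).trans Finset.card_biUnion_le
  have h2 : ((Finset.univ.filter fun a => ∃ T : Finset (Sym2 U), T ⊆ pairs U ∧
      ∀ b, IsLeaf l a b → ¬ HasPattern T b).card : ℝ) ≤ ∑ T ∈ (pairs U).powerset,
        ((Finset.univ.filter fun a => ∀ b, IsLeaf l a b → ¬ HasPattern T b).card : ℝ) := by
    exact_mod_cast h1
  refine h2.trans ((Finset.sum_le_card_nsmul _ _ _ fun T _ => card_missing_le hl hnd T).trans_eq ?_)
  rw [nsmul_eq_mul, Finset.card_powerset, card_pairs]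
  push_cast
  rfl

end SecondMoment

/-! ### From adjacency vectors to random graphs -/

section Graph

variable {V : Type*} [Fintype V] [DecidableEq V]

/-- The graph with a given adjacency vector. -/
def graphOf (a : Sym2 V → ZMod 2) : SimpleGraph V where
  Adj x y := x ≠ y ∧ a s(x, y) = 1
  symm := ⟨fun x y h => by rwa [ne_comm, Sym2.eq_swap]⟩
  loopless := ⟨fun _ h => h.1 rfl⟩

lemma graphOf_lc (v : V) (a : Sym2 V → ZMod 2) :
    graphOf (lc v a) = localComplement (graphOf a) v := by
  have key : ∀ p q r : ZMod 2, p + q * r = 1 ↔ Xor (p = 1) (q = 1 ∧ r = 1) := by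
    unfold Xor
    decide
  have hn : ∀ x, nbr v a x = 1 ↔ v ≠ x ∧ a s(v, x) = 1 := by
    intro x
    by_cases h : x = v
    · simp [nbr, h]
    · simp [nbr, h, Ne.symm h]
  ext x y
  have h1 : lc v a s(x, y) = a s(x, y) + nbr v a x * nbr v a y := rfl
  change (x ≠ y ∧ lc v a s(x, y) = 1) ↔ (x ≠ y ∧ Xor (x ≠ y ∧ a s(x, y) = 1)
    ((v ≠ x ∧ a s(v, x) = 1) ∧ (v ≠ y ∧ a s(v, y) = 1)))
  rw [h1, key, hn, hn]
  exact and_congr_right fun h => by simp [h]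

lemma IsVertexMinor.induce_univ_of_isLeaf {G : SimpleGraph V} {l : List V}
    {a b : Sym2 V → ZMod 2} (hab : IsLeaf l a b)
    (h : IsVertexMinor G Set.univ ((graphOf a).induce Set.univ)) :
    IsVertexMinor G Set.univ ((graphOf b).induce Set.univ) := by
  induction l generalizing a with
  | nil => rwa [show b = a from hab]
  | cons v l ih =>
    rcases hab with hab | hab
    · exact ih hab h
    · refine ih hab ?_
      have h1 := IsVertexMinor.localComplement ⟨v, Set.mem_univ v⟩ h
      have h2 : VertexMinor.localComplement ((graphOf a).induce Set.univ) ⟨v, Set.mem_univ v⟩ =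
          (graphOf (lc v a)).induce Set.univ := by
        rw [graphOf_lc]
        ext x y
        simp [VertexMinor.localComplement, Subtype.ext_iff]
      rwa [h2] at h1

lemma IsVertexMinor.induce_of_subset {G G' : SimpleGraph V} (D : Finset V) :
    ∀ {S : Set V}, IsVertexMinor G S (G'.induce S) → (D : Set V) ⊆ S →
      IsVertexMinor G (S \ D) (G'.induce (S \ D)) := by
  induction D using Finset.induction_on with
  | empty =>
    intro S h _
    rwa [show S \ (∅ : Finset V) = S by simp]
  | insert v D hv ih =>
    intro S h hD
    rw [Finset.coe_insert, Set.insert_subset_iff] at hD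
    have h1 := ih h hD.2
    have hT : S \ (insert v D : Finset V) = (S \ D) \ {v} := by
      rw [Finset.coe_insert, Set.sdiff_sdiff, Set.union_comm, Set.insert_eq]
    exact IsVertexMinor.delete (⟨v, hD.1, by simpa using hv⟩ : (S \ D : Set V)) hT h1

/-- Do all complementations outside `U` first, then delete the complement of `U`. -/
lemma isUniversal_of_forall {k : ℕ} {a : Sym2 V → ZMod 2}
    (h : ∀ U : Finset V, U.card = k → ∀ T : Finset (Sym2 U), T ⊆ pairs U →
      ∃ b, IsLeaf Uᶜ.toList a b ∧ HasPattern T b) : IsUniversal k (graphOf a) := by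
  classical
  intro W hW H
  obtain ⟨U, rfl⟩ : ∃ U : Finset V, (U : Set V) = W := ⟨W.toFinset, by simp⟩
  rw [Set.encard_coe_eq_coe_finsetCard, Nat.cast_inj] at hW
  obtain ⟨b, hb, hT⟩ := h U hW ((pairs U).filter fun e => e ∈ H.edgeSet)
    (Finset.filter_subset _ _)
  have h1 := (IsVertexMinor.start (G := graphOf a)).induce_univ_of_isLeaf hb
  have h2 := h1.induce_of_subset Uᶜ (Set.subset_univ _)
  have h3 : (Set.univ \ (Uᶜ : Finset V) : Set V) = U := by
    ext x
    simp
  rw [h3] at h2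
  convert h2
  ext x y
  have h4 := hT (s(x, y) : Sym2 U)
  by_cases hxy : x = y
  · simp [hxy]
  · have h5 : (s(x, y) : Sym2 U) ∈ pairs U := by simp [pairs, hxy]
    have h6 := h4 h5
    rw [Finset.mem_filter, and_iff_right h5, SimpleGraph.mem_edgeSet] at h6
    rw [← h6]
    have h7 : (x : V) ≠ y := fun h => hxy (Subtype.ext h)
    simp [graphOf, h7]

-- The loop coordinates of a vector are free, so each graph has 2^|V| representatives.
open Classical in
lemma card_mul_two_pow_le (S : Set (SimpleGraph V)) :
    (Finset.univ.filter fun G => G ∈ S).card * 2 ^ Fintype.card V ≤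
      (Finset.univ.filter fun a : Sym2 V → ZMod 2 => graphOf a ∈ S).card := by
  have h1 : 2 ^ Fintype.card V = (Finset.univ : Finset (V → ZMod 2)).card := by
    rw [Finset.card_univ, Fintype.card_fun, ZMod.card]
  rw [h1, ← Finset.card_product]
  let vec : SimpleGraph V × (V → ZMod 2) → Sym2 V → ZMod 2 := fun p =>
    Sym2.lift ⟨fun x y => if x = y then p.2 x else if p.1.Adj x y then 1 else 0, fun x y => by
      by_cases h : x = y
      · simp [h]
      · simp [h, Ne.symm h, p.1.adj_comm]⟩
  have hvec : ∀ p x y, vec p s(x, y) = if x = y then p.2 x else if p.1.Adj x y then 1 else 0 :=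
    fun _ _ _ => rfl
  have hgraph : ∀ p, graphOf (vec p) = p.1 := by
    intro p
    ext x y
    by_cases h : x = y
    · simp [h]
    · simp [graphOf, hvec, h]
  refine Finset.card_le_card_of_injOn vec ?_ ?_
  · intro p hp
    simpa [hgraph] using hp
  · intro p _ q _ h
    refine Prod.ext ?_ ?_
    · rw [← hgraph p, h, hgraph]
    · funext x
      have := congrFun h s(x, x)
      simpa [hvec] using this

open Classical in
/-- The binomial random graph with parameter `1/2` is uniform. -/
lemma binomialRandom_half_real_le (S : Set (SimpleGraph V)) :
    (SimpleGraph.binomialRandom V (⟨1 / 2, by norm_num, by norm_num⟩ : unitInterval)).real S ≤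
      (Finset.univ.filter fun a : Sym2 V → ZMod 2 => graphOf a ∈ S).card /
        Fintype.card (Sym2 V → ZMod 2) := by
  set p : unitInterval := ⟨1 / 2, by norm_num, by norm_num⟩ with hp
  have hsingle : ∀ G : SimpleGraph V, (SimpleGraph.binomialRandom V p).real {G} =
      (1 / 2) ^ (Fintype.card V).choose 2 := by
    intro G
    have hle : G.edgeSet.ncard ≤ (Fintype.card V).choose 2 := by
      rw [← SimpleGraph.coe_edgeFinset, Set.ncard_coe_finset]
      exact SimpleGraph.card_edgeFinset_le_card_choose_two
    rw [MeasureTheory.measureReal_def, SimpleGraph.binomialRandom_singleton, Nat.card_eq_fintype_card]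
    have h1 : ((unitInterval.toNNReal p : NNReal) : ℝ) = 1 / 2 := rfl
    have h2 : ((unitInterval.toNNReal (unitInterval.symm p) : NNReal) : ℝ) = 1 / 2 := by
      change (1 : ℝ) - 1 / 2 = 1 / 2
      norm_num
    rw [ENNReal.toReal_mul, ENNReal.toReal_pow, ENNReal.toReal_pow, ENNReal.coe_toReal,
      ENNReal.coe_toReal, h1, h2, ← pow_add, Nat.add_sub_cancel' hle]
  have hS : (SimpleGraph.binomialRandom V p).real S ≤
      (Finset.univ.filter fun G => G ∈ S).card * (1 / 2) ^ (Fintype.card V).choose 2 := by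
    have h1 : S = ⋃ G ∈ Finset.univ.filter fun G => G ∈ S, {G} := by
      ext
      simp
    conv_lhs => rw [h1]
    refine (MeasureTheory.measureReal_biUnion_finset_le _ _).trans_eq ?_
    rw [Finset.sum_congr rfl fun G _ => hsingle G, Finset.sum_const, nsmul_eq_mul]
  have hX : (Fintype.card (Sym2 V → ZMod 2) : ℝ) =
      2 ^ (Fintype.card V).choose 2 * 2 ^ Fintype.card V := by
    rw [Fintype.card_fun, ZMod.card, Sym2.card, Nat.choose_succ_succ', Nat.choose_one_right,
      add_comm, pow_add]
    push_cast
    ring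
  have h3 : ((Finset.univ.filter fun G => G ∈ S).card : ℝ) * 2 ^ Fintype.card V ≤
      (Finset.univ.filter fun a : Sym2 V → ZMod 2 => graphOf a ∈ S).card := by
    exact_mod_cast card_mul_two_pow_le S
  refine hS.trans ?_
  rw [hX, le_div_iff₀ (by positivity)]
  refine le_trans (le_of_eq ?_) h3
  rw [one_div, inv_pow]
  field_simp

/-- An upper bound for the probability that `G(n, 1/2)` is not `k`-vertex-minor universal. -/
lemma binomialRandom_half_not_isUniversal_le (k : ℕ) :
    (SimpleGraph.binomialRandom V (⟨1 / 2, by norm_num, by norm_num⟩ : unitInterval)).real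
        {G : SimpleGraph V | IsUniversal k G}ᶜ ≤
      (Fintype.card V).choose k * (2 ^ k.choose 2 * (2 ^ (10 * k) * (3 / 4) ^ (Fintype.card V - k) +
        2 ^ k.choose 2 * (9 / 16) ^ (Fintype.card V - k))) := by
  classical
  refine (binomialRandom_half_real_le _).trans ?_
  have hN : (0 : ℝ) < Fintype.card (Sym2 V → ZMod 2) := by exact_mod_cast Fintype.card_pos
  rw [div_le_iff₀ hN]
  set S := Finset.powersetCard k (Finset.univ : Finset V)
  set miss : Finset V → Finset (Sym2 V → ZMod 2) := fun U =>
    Finset.univ.filter fun a => ∃ T : Finset (Sym2 U), T ⊆ pairs U ∧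
      ∀ b, IsLeaf Uᶜ.toList a b → ¬ HasPattern T b
  have hsub : (Finset.univ.filter fun a : Sym2 V → ZMod 2 =>
      graphOf a ∈ {G : SimpleGraph V | IsUniversal k G}ᶜ) ⊆ S.biUnion miss := by
    intro a ha
    have h1 : ¬ IsUniversal k (graphOf a) := by simpa using ha
    by_contra hcon
    refine h1 (isUniversal_of_forall fun U hU T hT => ?_)
    by_contra hne
    refine hcon (Finset.mem_biUnion.mpr ⟨U, ?_, ?_⟩)
    · exact Finset.mem_powersetCard.mpr ⟨Finset.subset_univ _, hU⟩
    · refine Finset.mem_filter.mpr ⟨Finset.mem_univ _, T, hT, fun b hb hpat => ?_⟩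
      exact hne ⟨b, hb, hpat⟩
  have h2 := (Finset.card_le_card hsub).trans Finset.card_biUnion_le
  have h3 : ∀ U ∈ S, ((miss U).card : ℝ) ≤ 2 ^ k.choose 2 *
      ((2 ^ (10 * k) * (3 / 4) ^ (Fintype.card V - k) +
        2 ^ k.choose 2 * (9 / 16) ^ (Fintype.card V - k)) *
          Fintype.card (Sym2 V → ZMod 2)) := by
    intro U hU
    have hUk := (Finset.mem_powersetCard.mp hU).2
    have h4 := card_exists_missing_le (U := U) (l := Uᶜ.toList) (by simp)
      (Finset.nodup_toList _)
    rwa [Finset.length_toList, Finset.card_compl, hUk] at h4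
  refine le_trans (le_of_eq (by congr!)) ((Nat.cast_le (α := ℝ).mpr h2).trans ?_)
  rw [Nat.cast_sum]
  refine (Finset.sum_le_card_nsmul _ _ _ h3).trans_eq ?_
  rw [nsmul_eq_mul, Finset.card_powersetCard, Finset.card_univ]
  ring

end Graph

/-! ### Estimating the exponent -/

section Asymptotics

lemma two_fifths_le_logb : 2 / 5 ≤ Real.logb 2 (4 / 3) := by
  rw [Real.le_logb_iff_rpow_le one_lt_two (by norm_num)]
  refine le_of_pow_le_pow_left₀ (n := 5) (by norm_num) (by norm_num) ?_
  rw [← Real.rpow_natCast, ← Real.rpow_mul (by norm_num)]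
  norm_num

lemma logb_le_one : Real.logb 2 (4 / 3) ≤ 1 := by
  rw [Real.logb_le_iff_le_rpow one_lt_two (by norm_num)]
  norm_num

lemma logb_one_add_le {x : ℝ} (hx : 0 ≤ x) : Real.logb 2 (1 + x) ≤ 2 * x := by
  have h1 : Real.log (1 + x) ≤ x := by
    have := Real.log_le_sub_one_of_pos (show 0 < 1 + x by linarith)
    linarith
  have h2 : 1 / 2 ≤ Real.log 2 := by linarith [Real.log_two_gt_d9]
  rw [Real.logb, div_le_iff₀ (by linarith)]
  nlinarith

/-- The combined first and second moment bound, in exponential form. -/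
lemma le_two_rpow_of_le {k n : ℕ} {P : ℝ} (hk : 1 ≤ k) (hkn : k ≤ n) (hP1 : P ≤ 1)
    (hP : P ≤ n.choose k * (2 ^ k.choose 2 * (2 ^ (10 * k) * (3 / 4) ^ (n - k) +
      2 ^ k.choose 2 * (9 / 16) ^ (n - k)))) :
    P ≤ (2 : ℝ) ^ ((k : ℝ) * Real.logb 2 n + 12 * k + (k : ℝ) ^ 2 / 2 -
      n * Real.logb 2 (4 / 3)) := by
  have hk' : (1 : ℝ) ≤ k := by exact_mod_cast hk
  have hn : (1 : ℝ) ≤ n := by exact_mod_cast hk.trans hkn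
  set L := Real.logb 2 (4 / 3) with hL
  have hL1 : L ≤ 1 := logb_le_one
  have h2L : (2 : ℝ) ^ (-L) = 3 / 4 := by
    rw [Real.rpow_neg (by norm_num), hL, Real.rpow_logb (by norm_num) (by norm_num) (by norm_num)]
    norm_num
  set Q : ℝ := 2 ^ k.choose 2 * (3 / 4) ^ (n - k) with hQ
  have hQ0 : 0 < Q := by positivity
  have hbound : P ≤ (n : ℝ) ^ k * (2 ^ (10 * k + 1) * Q) := by
    have hnk : (1 : ℝ) ≤ (n : ℝ) ^ k := one_le_pow₀ hn
    have hp : (1 : ℝ) ≤ 2 ^ (10 * k) := one_le_pow₀ one_le_two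
    have hp' : (2 : ℝ) ^ (10 * k + 1) = 2 * 2 ^ (10 * k) := by rw [pow_succ]; ring
    rcases le_total Q 1 with h | h
    · refine hP.trans ?_
      have hch : (n.choose k : ℝ) ≤ (n : ℝ) ^ k := by exact_mod_cast Nat.choose_le_pow n k
      have h9 : ((9 : ℝ) / 16) ^ (n - k) = (3 / 4) ^ (n - k) * (3 / 4) ^ (n - k) := by
        rw [← mul_pow]
        norm_num
      have h3 : (2 : ℝ) ^ k.choose 2 * (2 ^ (10 * k) * (3 / 4) ^ (n - k) +
          2 ^ k.choose 2 * (9 / 16) ^ (n - k)) = 2 ^ (10 * k) * Q + Q * Q := by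
        rw [h9, hQ]
        ring
      rw [h3]
      refine mul_le_mul hch ?_ (by positivity) (by positivity)
      rw [hp']
      nlinarith
    -- For Q ≥ 1 the claimed bound already exceeds 1.
    · refine hP1.trans ?_
      have h3 : (1 : ℝ) ≤ 2 ^ (10 * k + 1) := one_le_pow₀ one_le_two
      exact one_le_mul_of_one_le_of_one_le hnk (one_le_mul_of_one_le_of_one_le h3 h)
  refine hbound.trans ?_
  have e1 : (n : ℝ) ^ k = (2 : ℝ) ^ ((k : ℝ) * Real.logb 2 n) := by
    rw [mul_comm, Real.rpow_mul (by norm_num), Real.rpow_logb (by norm_num) (by norm_num)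
      (by linarith), Real.rpow_natCast]
  have e2 : (2 : ℝ) ^ (10 * k + 1) = (2 : ℝ) ^ (10 * (k : ℝ) + 1) := by
    rw [← Real.rpow_natCast]
    push_cast
    rfl
  have e3 : ((3 : ℝ) / 4) ^ (n - k) = (2 : ℝ) ^ (-L * ((n : ℝ) - k)) := by
    rw [Real.rpow_mul (by norm_num), h2L, ← Nat.cast_sub hkn, Real.rpow_natCast]
  have e4 : (2 : ℝ) ^ k.choose 2 = (2 : ℝ) ^ ((k : ℝ) * (k - 1) / 2) := by
    rw [← Nat.cast_choose_two, Real.rpow_natCast]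
  rw [hQ, e1, e2, e3, e4, ← Real.rpow_add two_pos, ← Real.rpow_add two_pos,
    ← Real.rpow_add two_pos]
  -- The linear terms are 10k + 1 - k/2 + Lk, at most 12k since L ≤ 1 ≤ k.
  refine Real.rpow_le_rpow_of_exponent_le one_le_two ?_
  nlinarith

lemma exponent_le {c₀ c : ℝ} (hc₀ : 0 < c₀) (hc : c₀ ≤ c) {k n : ℕ} (hk : 1 ≤ k)
    (hn : (1 + c) * (1 / (2 * Real.logb 2 (4 / 3))) * (k : ℝ) ^ 2 ≤ n)
    (hε : (4 + (26 + 4 * Real.logb 2 k) / c₀) / k ≤ 1) :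
    (k : ℝ) * Real.logb 2 n + 12 * k + (k : ℝ) ^ 2 / 2 - n * Real.logb 2 (4 / 3) ≤
      -((1 + -((4 + (26 + 4 * Real.logb 2 k) / c₀) / k)) * c * (k : ℝ) ^ 2 / 2) := by
  have hk' : (1 : ℝ) ≤ k := by exact_mod_cast hk
  have hL := two_fifths_le_logb
  set L := Real.logb 2 (4 / 3)
  set ε := (4 + (26 + 4 * Real.logb 2 k) / c₀) / k with hεdef
  have hlk : 0 ≤ Real.logb 2 k := Real.logb_nonneg one_lt_two hk'
  -- The true excess d of `n` replaces `c`: `n` is unbounded in terms of `c`, while log n is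
  -- controlled by d.
  obtain ⟨d, hd⟩ : ∃ d : ℝ, (n : ℝ) * L = (1 + d) * k ^ 2 / 2 :=
    ⟨2 * (n * L) / k ^ 2 - 1, by field_simp; ring⟩
  have hcd : c ≤ d := by
    have h1 : (1 + c) * (1 / (2 * L)) * (k : ℝ) ^ 2 * L ≤ n * L :=
      mul_le_mul_of_nonneg_right hn (by linarith)
    have h2 : (1 + c) * (1 / (2 * L)) * (k : ℝ) ^ 2 * L = (1 + c) * k ^ 2 / 2 := by
      have : L ≠ 0 := by linarith
      field_simp
    rw [h2, hd] at h1
    have h3 : (0 : ℝ) < k ^ 2 := by positivity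
    nlinarith
  have hd0 : 0 < d := by linarith
  have hnpos : (0 : ℝ) < n := by
    have h1 : 0 < (n : ℝ) * L := by rw [hd]; positivity
    exact pos_of_mul_pos_left h1 (by linarith)
  have hnle : (n : ℝ) ≤ 2 * (1 + d) * k ^ 2 := by
    have h1 : (n : ℝ) * (2 / 5) ≤ n * L := mul_le_mul_of_nonneg_left hL hnpos.le
    have h2 : 0 < (1 + d) * (k : ℝ) ^ 2 := by positivity
    rw [hd] at h1
    linarith
  have hlog : Real.logb 2 n ≤ 1 + 2 * d + 2 * Real.logb 2 k := by
    refine (Real.logb_le_logb_of_le one_lt_two hnpos hnle).trans ?_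
    rw [Real.logb_mul (by positivity) (by positivity), Real.logb_mul (by norm_num) (by positivity),
      Real.logb_self_eq_one one_lt_two, Real.logb_pow]
    have := logb_one_add_le hd0.le
    push_cast
    linarith
  -- This dictates ε: the part 4/k pays for 2d, and the part over `c₀` pays for 13 + 2 log k because
  -- d ≥ `c₀`.
  have hεd : (k : ℝ) * (2 * d + 13 + 2 * Real.logb 2 k) ≤ ε * d * k ^ 2 / 2 := by
    have h1 : ε * d * (k : ℝ) ^ 2 / 2 =
        k * (2 * d + (13 + 2 * Real.logb 2 k) * (d / c₀)) := by
      rw [hεdef]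
      field_simp
      ring
    rw [h1]
    have h2 : 1 ≤ d / c₀ := (one_le_div hc₀).mpr (hc.trans hcd)
    refine mul_le_mul_of_nonneg_left ?_ (by linarith)
    nlinarith
  have hmain : (1 - ε) * c * (k : ℝ) ^ 2 ≤ (1 - ε) * d * k ^ 2 :=
    mul_le_mul_of_nonneg_right (mul_le_mul_of_nonneg_left hcd (by linarith)) (by positivity)
  have hlog' := mul_le_mul_of_nonneg_left hlog (show (0 : ℝ) ≤ k by linarith)
  rw [hd]
  linarith

lemma tendsto_error (c₀ : ℝ) :
    Tendsto (fun k : ℕ => (4 + (26 + 4 * Real.logb 2 k) / c₀) / (k : ℝ)) atTop (𝓝 0) := by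
  have h1 : Tendsto (fun k : ℕ => Real.log k / (k : ℝ)) atTop (𝓝 0) :=
    (Real.isLittleO_log_id_atTop.tendsto_div_nhds_zero).comp tendsto_natCast_atTop_atTop
  have h2 : Tendsto (fun k : ℕ => (4 + 26 / c₀) / (k : ℝ)) atTop (𝓝 0) :=
    tendsto_const_div_atTop_nhds_zero_nat _
  have h3 := h2.add (h1.const_mul (4 / (Real.log 2 * c₀)))
  rw [mul_zero, add_zero] at h3
  refine h3.congr fun k => ?_
  rw [Real.logb]
  ring

end Asymptotics

end VertexMinor

theorem theorem1p1 (c₀ : ℝ) (hc₀ : 0 < c₀) :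
    ∃ δ : ℕ → ℝ, Tendsto δ atTop (𝓝 0) ∧
      ∀ c : ℝ, c₀ ≤ c → ∀ k n : ℕ,
        (1 + c) * (1 / (2 * Real.logb 2 (4 / 3))) * (k : ℝ) ^ 2 ≤ (n : ℝ) →
          1 - (2 : ℝ) ^ (-((1 + δ k) * c * (k : ℝ) ^ 2 / 2)) ≤
            (SimpleGraph.binomialRandom (Fin n)
                (⟨1 / 2, by norm_num, by norm_num⟩ : unitInterval)).real
              {G : SimpleGraph (Fin n) | VertexMinor.IsUniversal k G} := by
  -- Truncation at 1 makes the claimed lower bound 0 when the error term is at least 1.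
  refine ⟨fun k => -min ((4 + (26 + 4 * Real.logb 2 k) / c₀) / k) 1, ?_, ?_⟩
  · simpa using ((VertexMinor.tendsto_error c₀).min (tendsto_const_nhds (x := (1 : ℝ)))).neg
  · intro c hc k n hn
    set μ := SimpleGraph.binomialRandom (Fin n)
      (⟨1 / 2, by norm_num, by norm_num⟩ : unitInterval) with hμ
    set A := {G : SimpleGraph (Fin n) | VertexMinor.IsUniversal k G} with hA
    -- Subadditivity suffices, so measurability of `A` is not needed.
    have hcompl : 1 ≤ μ.real A + μ.real Aᶜ := by
      have h := MeasureTheory.measureReal_union_le (μ := μ) A Aᶜ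
      rwa [Set.union_compl_self, MeasureTheory.probReal_univ] at h
    have hnonneg : 0 ≤ μ.real A := MeasureTheory.measureReal_nonneg
    rcases Nat.eq_zero_or_pos k with rfl | hk
    · simp
    rcases le_total ((4 + (26 + 4 * Real.logb 2 k) / c₀) / k) 1 with hε | hε
    · simp only [min_eq_left hε]
      have hbad := VertexMinor.binomialRandom_half_not_isUniversal_le (V := Fin n) k
      rw [← hμ, ← hA, Fintype.card_fin] at hbad
      have h1 : μ.real Aᶜ ≤ (2 : ℝ) ^
          (-((1 + -((4 + (26 + 4 * Real.logb 2 k) / c₀) / k)) * c * (k : ℝ) ^ 2 / 2)) := by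
        rcases lt_or_ge n k with hlt | hle
        · refine hbad.trans ?_
          rw [Nat.choose_eq_zero_of_lt hlt, Nat.cast_zero, zero_mul]
          positivity
        · exact (VertexMinor.le_two_rpow_of_le hk hle MeasureTheory.measureReal_le_one hbad).trans
            (Real.rpow_le_rpow_of_exponent_le one_le_two (VertexMinor.exponent_le hc₀ hc hk hn hε))
      linarith
    · simp [min_eq_right hε]
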